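/- Let $\mathsf{Act}$ be a set of actions with an involutive complementation $a\mapsto\overline a$, and let $\tau,\checkmark\notin\mathsf{Act}$ be distinct. Terms of infinitary CCS are given by $$p ::= 1 \mid A \mid \mu.p \mid \sum_{i\in I} p_i,$$ where $\mu\in\mathsf{Act}\cup\{\tau\}$, $I$ is a countable (possibly empty) index set, $0$ denotes the empty sum, and $A$ ranges over a set of definitional constants, each with a definition $A\stackrel{\mathrm{def}}{=}p_A$; the set of constants is rich enough that for every countable system of (possibly mutually recursive) defining equations there are constants with exactly these definitions. The transition relations are the least ones such that $1\xrightarrow{\checkmark}0$; $\mu.p\xrightarrow{\mu}p$; $\sum_{i}p_i\xrightarrow{\lambda}p'$ if $p_i\xrightarrow{\lambda}p'$ for some $i$; and $A\xrightarrow{\lambda}p'$ if $p_A\xrightarrow{\lambda}p'$. In a composition $p\parallel r$ of a server $p$ and a client $r$ either component may move alone, and $p\parallel r\xrightarrow{\tau}p'\parallel r'$ if $p\xrightarrow{a}p'$ and $r\xrightarrow{\overline a}r'$ for some $a \in \mathsf{Act}$. A computation is a finite or infinite sequence $p_0\parallel r_0\xrightarrow{\tau}p_1\parallel r_1\xrightarrow{\tau}\cdots$;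 it is maximal if it is infinite or its last state has no $\tau$-transition. Write $p\ \mathrm{must}\ r$ if every maximal computation from $p\parallel r$ contains a state $p_k\parallel r_k$ with $r_k\xrightarrow{\checkmark}$. Define $r_1\sqsubseteq_{\mathrm{clt}}r_2$ if for every $p$, $p\ \mathrm{must}\ r_1$ implies $p\ \mathrm{must}\ r_2$. A client $r$ is usable if $p\ \mathrm{must}\ r$ for some $p$. For $s\in\mathsf{Act}^*$ write $p\Rightarrow_{\not\checkmark}^{s}q$ if $p$ can reach $q$ by transitions in $\mathsf{Act}\cup\{\tau\}$ whose visible actions spell $s$, with no state on the way, $p$ and $q$ included, able to perform $\checkmark$; write $p\Rightarrow_{\not\checkmark}^{s}$ if such a $q$ exists. For an infinite sequence $u$ of actions, $p\Rightarrow_{\not\checkmark}^{u}$ means that $p$ has an infinite run over $\mathsf{Act}\cup\{\tau\}$ whose visible actions spell $u$ and none of whose states can perform $\checkmark$. Put $S(q)=\{a\in\mathsf{Act}: q\xrightarrow{a}\}$ and $$\mathrm{Acc}_{\not\checkmark}(p,s)=\{S(q): p\Rightarrow_{\not\checkmark}^{s}q,\ q\not\xrightarrow{\tau}\}.$$ The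 usability of $r$ along $s$, written $r\downarrow s$, is defined by induction on $s$: $r\downarrow\varepsilon$ iff $r$ is usable; $r\downarrow as$ iff $r$ is usable and, whenever $r\Rightarrow_{\not\checkmark}^{a}$, $\bigl(\sum_{r\Rightarrow_{\not\checkmark}^{a}q}\tau.q\bigr)\downarrow s$ (this sum ranges over a countable set). For infinite $u$, $r\downarrow u$ means $r\downarrow s$ for every finite prefix $s$ of $u$. Let $\mathrm{ua}(r,s)=\{a\in\mathsf{Act}: r\Rightarrow_{\not\checkmark}^{sa}\text{ implies } r\downarrow sa\}$. Let $r_1\preccurlyeq_{\mathrm{clt}}r_2$ if 1. for every $s\in\mathsf{Act}^*$ with $r_1\downarrow s$: (a) $r_2\downarrow s$; and (b) for every $B\in\mathrm{Acc}_{\not\checkmark}(r_2,s)$ there is $A\in\mathrm{Acc}_{\not\checkmark}(r_1,s)$ with $A\cap\mathrm{ua}(r_1,s)\subseteq B$; 2. for every finite or infinite sequence $w$ of actions with $r_1\downarrow w$, $r_2\Rightarrow_{\not\checkmark}^{w}$ implies $r_1\Rightarrow_{\not\checkmark}^{w}$. **Theorem.** For all terms $r_1,r_2$ of infinitary CCS,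 $r_1\sqsubseteq_{\mathrm{clt}}r_2$ if and only if $r_1\preccurlyeq_{\mathrm{clt}}r_2$. -/

import Mathlib

namespace CCS

universe u v

/-- Visible actions together with the internal action `τ`. -/
inductive ActTau (Act : Type u) : Type u
  | tau : ActTau Act
  | act : Act → ActTau Act

/-- Labels of transitions: visible actions, `τ`, and the success action `ok`. -/
inductive Label (Act : Type u) : Type u
  | mu : ActTau Act → Label Act
  | ok : Label Act

/-- The label of a visible action. -/
abbrev Label.act {Act : Type u} (a : Act) : Label Act := Label.mu (ActTau.act a)

/-- The label `τ`. -/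
abbrev Label.tau {Act : Type u} : Label Act := Label.mu ActTau.tau

/-- Terms of infinitary CCS over the actions `Act` and the definitional constants `K`:
the success constant, constants, prefixes `μ.p`, and external sums over countable index sets
(represented as subsets of `ℕ`, possibly empty). -/
inductive Term (Act : Type u) (K : Type v) : Type (max u v)
  | unit : Term Act K
  | const : K → Term Act K
  | pre : ActTau Act → Term Act K → Term Act K
  | sum : (I : Set ℕ) → (I → Term Act K) → Term Act K

/-- The process `0`, the empty external sum. -/
def Term.nil {Act : Type u} {K : Type v} : Term Act K :=
  Term.sum ∅ (fun i => i.2.elim)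

/-- Renaming of the constants in a term. -/
def Term.mapConst {Act : Type u} {K : Type v} {L : Type*} (f : K → L) :
    Term Act K → Term Act L
  | .unit => .unit
  | .const A => .const (f A)
  | .pre m p => .pre m (p.mapConst f)
  | .sum I p => .sum I (fun i => (p i).mapConst f)

/-- Every constant `A : K` has the associated definition `A ≝ defs A`.  The language allows
arbitrary definitions: for every countable system of definitions `Xₙ ≝ e n` (`n : ℕ`), whose
right-hand sides may mention the existing constants (`Sum.inl`) and the names `Xₘ` being
introduced (`Sum.inr m`), there are constants `A n` in `K` with exactly these definitions. -/
def AllowsDefinitions {Act : Type u} {K : Type v} (defs : K → Term Act K) : Prop :=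
  ∀ e : ℕ → Term Act (K ⊕ ℕ), ∃ A : ℕ → K,
    ∀ n, defs (A n) = (e n).mapConst (Sum.elim id A)

/-- The operational semantics of CCS. -/
inductive Step {Act : Type u} {K : Type v} (defs : K → Term Act K) :
    Term Act K → Label Act → Term Act K → Prop
  | ok : Step defs .unit .ok .nil
  | pre (m : ActTau Act) (p : Term Act K) : Step defs (.pre m p) (.mu m) p
  | sum (I : Set ℕ) (p : I → Term Act K) (i : I) (l : Label Act) (p' : Term Act K) :
      Step defs (p i) l p' → Step defs (.sum I p) l p'
  | const (A : K) (l : Label Act) (p' : Term Act K) :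
      Step defs (defs A) l p' → Step defs (.const A) l p'

section

variable {Act : Type u} {K : Type v} (co : Act → Act) (defs : K → Term Act K)

/-- The transitions of a composition `p ∥ r`, written as the pair `(p, r)`. -/
inductive ParStep : Term Act K × Term Act K → Label Act → Term Act K × Term Act K → Prop
  | left (p p' r : Term Act K) (l : Label Act) :
      Step defs p l p' → ParStep (p, r) l (p', r)
  | right (p r r' : Term Act K) (l : Label Act) :
      Step defs r l r' → ParStep (p, r) l (p, r')
  | synch (p p' r r' : Term Act K) (a : Act) :
      Step defs p (.act a) p' → Step defs r (.act (co a)) r' → ParStep (p, r) .tau (p', r')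

/-- `r` can report success immediately. -/
def CanOk (r : Term Act K) : Prop := ∃ r', Step defs r .ok r'

/-- `r` has no `τ` transition. -/
def Stable (r : Term Act K) : Prop := ¬ ∃ r', Step defs r .tau r'

/-- `c 0, c 1, …, c N` (infinite if `N = ⊤`) is a maximal computation: consecutive states are
linked by `τ` transitions, and the last state, if there is one, has no `τ` transition. -/
def IsMaximalComputation (N : ℕ∞) (c : ℕ → Term Act K × Term Act K) : Prop :=
  (∀ k : ℕ, (k : ℕ∞) < N → ParStep co defs (c k) .tau (c (k + 1))) ∧
  (∀ n : ℕ, N = n → ¬ ∃ x, ParStep co defs (c n) .tau x)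

/-- `Must p r`: every maximal computation from `p ∥ r` is client-successful. -/
def Must (p r : Term Act K) : Prop :=
  ∀ (N : ℕ∞) (c : ℕ → Term Act K × Term Act K), c 0 = (p, r) →
    IsMaximalComputation co defs N c → ∃ k : ℕ, (k : ℕ∞) ≤ N ∧ CanOk defs (c k).2

/-- The client preorder: every server satisfying `r₁` also satisfies `r₂`. -/
def ClientPreorder (r₁ r₂ : Term Act K) : Prop :=
  ∀ p : Term Act K, Must co defs p r₁ → Must co defs p r₂

/-- The usable clients: those satisfied by at least one server. -/
def Usable (r : Term Act K) : Prop := ∃ p : Term Act K, Must co defs p r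

/-- `UWT defs p s q`: the process `p` can perform the weak trace `s` and end in `q` without
passing through any state that can report success. -/
inductive UWT : Term Act K → List Act → Term Act K → Prop
  | refl (p : Term Act K) : ¬ CanOk defs p → UWT p [] p
  | act (p p' q : Term Act K) (a : Act) (s : List Act) :
      UWT p' s q → ¬ CanOk defs p → Step defs p (.act a) p' → UWT p (a :: s) q
  | tau (p p' q : Term Act K) (s : List Act) :
      UWT p' s q → ¬ CanOk defs p → Step defs p .tau p' → UWT p s q

/-- `p` can perform the finite trace `s` unsuccessfully. -/
def CanUWT (p : Term Act K) (s : List Act) : Prop := ∃ q, UWT defs p s q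

/-- The string of visible actions obtained by removing the `τ`s. -/
def visible (t : List (ActTau Act)) : List Act :=
  t.filterMap (fun m => match m with
    | .tau => none
    | .act a => some a)

/-- The prefix of length `n` of an infinite sequence. -/
def takePrefix {X : Type*} (w : ℕ → X) (n : ℕ) : List X := (List.range n).map w

/-- `p` can perform the infinite trace `w` unsuccessfully. -/
def CanUWTInf (p : Term Act K) (w : ℕ → Act) : Prop :=
  ∃ (t : ℕ → ActTau Act) (q : ℕ → Term Act K), q 0 = p ∧
    (∀ i, Step defs (q i) (.mu (t i)) (q (i + 1))) ∧
    (∀ i, ¬ CanOk defs (q i)) ∧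
    (∀ n, ∃ k, takePrefix w n = visible (takePrefix t k))

/-- The set of processes reachable from `r` by performing `s` unsuccessfully. -/
def afterU (r : Term Act K) (s : List Act) : Set (Term Act K) := {q | UWT defs r s q}

/-- The ready set of `q`: the visible actions it can perform strongly. -/
def readySet (q : Term Act K) : Set Act := {a | ∃ q', Step defs q (.act a) q'}

/-- The unsuccessful acceptance set of `p` after `s`. -/
def accU (p : Term Act K) (s : List Act) : Set (Set Act) :=
  {A | ∃ q, UWT defs p s q ∧ Stable defs q ∧ A = readySet defs q}

/-! Every process reaches only countably many processes, so that the internal sums below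
are terms of the language. -/

/-- The immediate unguarded components of a term. -/
def components : Term Act K → Set (Term Act K)
  | .unit => ∅
  | .const A => {defs A}
  | .pre _ _ => ∅
  | .sum _ p => Set.range p

theorem countable_reach {X : Type*} (f : X → Set X) (hf : ∀ x, (f x).Countable) (x : X) :
    {y | Relation.ReflTransGen (fun a b => b ∈ f a) x y}.Countable := by
  let S : ℕ → Set X := fun n => Nat.rec {x} (fun _ T => ⋃ y ∈ T, f y) n
  have hS : ∀ n, (S n).Countable := by
    intro n
    induction n with
    | zero => exact Set.countable_singleton x
    | succ n ih => exact ih.biUnion (fun y _ => hf y)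
  refine (Set.countable_iUnion hS).mono ?_
  intro y hy
  induction hy with
  | refl => exact Set.mem_iUnion.2 ⟨0, rfl⟩
  | tail _ h ih =>
    obtain ⟨n, hn⟩ := Set.mem_iUnion.1 ih
    exact Set.mem_iUnion.2 ⟨n + 1, Set.mem_biUnion hn h⟩

theorem countable_succ (p : Term Act K) : {p' | ∃ l, Step defs p l p'}.Countable := by
  have hc : ∀ x : Term Act K, (components defs x).Countable := by
    intro x
    cases x with
    | unit => exact Set.countable_empty
    | const A => exact Set.countable_singleton _
    | pre m p => exact Set.countable_empty
    | sum I p => exact Set.countable_range p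
  have h1 := countable_reach (components defs) hc p
  refine (h1.image (fun q => match q with
    | .pre _ r => r
    | _ => Term.nil)).mono ?_
  rintro p' ⟨l, h⟩
  induction h with
  | ok => exact ⟨.unit, Relation.ReflTransGen.refl, rfl⟩
  | pre m p => exact ⟨.pre m p, Relation.ReflTransGen.refl, rfl⟩
  | sum I p i l p' _ ih =>
    obtain ⟨q, hq, e⟩ := ih (countable_reach (components defs) hc _)
    exact ⟨q, Relation.ReflTransGen.head (Set.mem_range_self i) hq, e⟩
  | const A l p' _ ih =>
    obtain ⟨q, hq, e⟩ := ih (countable_reach (components defs) hc _)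
    exact ⟨q, Relation.ReflTransGen.head (Set.mem_singleton _) hq, e⟩

theorem afterU_countable (r : Term Act K) (s : List Act) : (afterU defs r s).Countable := by
  refine (countable_reach (fun p => {p' | ∃ l, Step defs p l p'}) (countable_succ defs) r).mono ?_
  intro q hq
  have hq' : UWT defs r s q := hq
  induction hq' with
  | refl p _ => exact Relation.ReflTransGen.refl
  | act p p' q a s h1 _ h ih => exact Relation.ReflTransGen.head ⟨_, h⟩ (ih h1)
  | tau p p' q s h1 _ h ih => exact Relation.ReflTransGen.head ⟨_, h⟩ (ih h1)

/-- The internal sum `⨁ X = ∑_{p ∈ X} τ.p` of a countable set of terms, whose elements are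
indexed by natural numbers through some injection. -/
noncomputable def intSum (X : Set (Term Act K)) (hX : X.Countable) : Term Act K :=
  haveI : Countable X := hX.to_subtype
  Term.sum (Set.range (exists_injective_nat X).choose) (fun i =>
    Term.pre .tau ((Equiv.ofInjective _ (exists_injective_nat X).choose_spec).symm i).1)

/-- Client usability of `r` along the finite unsuccessful trace `s`. -/
def UsableAlong : Term Act K → List Act → Prop
  | r, [] => Usable co defs r
  | r, a :: s => Usable co defs r ∧
      (CanUWT defs r [a] →
        UsableAlong (intSum (afterU defs r [a]) (afterU_countable defs r [a])) s)

/-- Client usability along an infinite trace: along all its finite prefixes. -/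
def UsableAlongInf (r : Term Act K) (w : ℕ → Act) : Prop :=
  ∀ n, UsableAlong co defs r (takePrefix w n)

/-- The usable actions for a client `r` after the trace `s`. -/
def usableActions (r : Term Act K) (s : List Act) : Set Act :=
  {a | CanUWT defs r (s ++ [a]) → UsableAlong co defs r (s ++ [a])}

/-- The semantic client preorder. -/
def SemanticClientPreorder (r₁ r₂ : Term Act K) : Prop :=
  (∀ s : List Act, UsableAlong co defs r₁ s →
    UsableAlong co defs r₂ s ∧
    ∀ B ∈ accU defs r₂ s, ∃ A ∈ accU defs r₁ s, A ∩ usableActions co defs r₁ s ⊆ B) ∧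
  (∀ s : List Act, UsableAlong co defs r₁ s → CanUWT defs r₂ s → CanUWT defs r₁ s) ∧
  (∀ w : ℕ → Act, UsableAlongInf co defs r₁ w → CanUWTInf defs r₂ w → CanUWTInf defs r₁ w)

end

/-! A concrete supply of constants allowing arbitrary definitions: a constant is a countable
system of definitions together with the index of one of its equations. -/

/-- The constants of the concrete supply. -/
inductive SystemConst (Act : Type u) : Type u
  | mk : (ℕ → Term Act (SystemConst Act ⊕ ℕ)) → ℕ → SystemConst Act

/-- The definitions of the constants of the concrete supply. -/
def SystemConst.defs {Act : Type u} :
    SystemConst Act → Term Act (SystemConst Act)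
  | .mk e n => (e n).mapConst (Sum.elim id (SystemConst.mk e))

theorem SystemConst.allowsDefinitions (Act : Type u) :
    AllowsDefinitions (SystemConst.defs (Act := Act)) :=
  fun e => ⟨SystemConst.mk e, fun _ => rfl⟩

end CCS

namespace CCS

universe u v

section

variable {Act : Type u} {K : Type v}

/-! `Must` is recast as the inductive predicate `MustI`. From it one reads off that unsuccessful
`τ`-steps of a satisfied composition are well-founded and cannot end in deadlock. Usability along
`s` then means that, for every prefix `s'` of `s`, a single server satisfies all unsuccessful
`s'`-residuals (`usableAlong_iff`).

Soundness: if `p` satisfies `r₁`, then `r₁` is usable along every `s` whose complement `p` performs.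
Suppose `p` fails `r₂`. At a failing pair reached along `s`, clause 1 and the finite part of clause
2 exclude divergence and deadlock, so by `MustI.of_convergent` failure is passed on by one more
visible action. Iterating gives an infinite trace of `r₂`. The infinite part of clause 2 transfers
it to `r₁`, contradicting well-foundedness.

Completeness: a server can perform the complement of `s` and end in any `T` satisfying the
`s`-residuals of `r₁`, with a silent escape to a satisfying server at each earlier point
(`exists_server_of_trace`). Hence `T` also satisfies the `s`-residuals of `r₂`. Suitable choices of
`T` give clause 1 and finite clause 2; an infinite chain of such branches gives infinite clause 2.
-/

/-! ### Sequences, prefixes and countable sums. -/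

theorem exists_seq_of_step {α : Type*} {P : α → Prop} {R : α → α → Prop} {x : α} (hx : P x)
    (h : ∀ x, P x → ∃ y, R x y ∧ P y) :
    ∃ f : ℕ → α, f 0 = x ∧ ∀ n, P (f n) ∧ R (f n) (f (n + 1)) := by
  choose g hg using h
  let F : ℕ → {x // P x} := fun n => Nat.rec ⟨x, hx⟩ (fun _ y => ⟨g y.1 y.2, (hg y.1 y.2).2⟩) n
  exact ⟨fun n => (F n).1, rfl, fun n => ⟨(F n).2, (hg (F n).1 (F n).2).1⟩⟩

theorem not_acc_of_descending {α : Type*} {R : α → α → Prop} {x : α} (hx : Acc R x) :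
    ∀ f : ℕ → α, f 0 = x → (∀ n, R (f (n + 1)) (f n)) → False := by
  induction hx with
  | intro x _ ih =>
    intro f h0 h
    exact ih (f 1) (h0 ▸ h 0) (fun n => f (n + 1)) rfl (fun n => h (n + 1))

theorem takePrefix_succ {X : Type*} (w : ℕ → X) (n : ℕ) :
    takePrefix w (n + 1) = takePrefix w n ++ [w n] := by
  simp [takePrefix, List.range_succ]

theorem takePrefix_add {X : Type*} (w : ℕ → X) (m n : ℕ) :
    takePrefix w (m + n) = takePrefix w m ++ takePrefix (fun i => w (m + i)) n := by
  induction n with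
  | zero => simp [takePrefix]
  | succ n ih => rw [← add_assoc, takePrefix_succ, ih, takePrefix_succ, List.append_assoc]

theorem takePrefix_length {X : Type*} (w : ℕ → X) (n : ℕ) : (takePrefix w n).length = n := by
  simp [takePrefix]

theorem visible_append (s t : List (ActTau Act)) : visible (s ++ t) = visible s ++ visible t := by
  simp [visible]

theorem Term.mapConst_mapConst {L : Type*} {M : Type*} (f : K → L) (g : L → M)
    (p : Term Act K) : (p.mapConst f).mapConst g = p.mapConst (g ∘ f) := by
  induction p with
  | unit => rfl
  | const A => rfl
  | pre m p ih => simp [Term.mapConst, ih]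
  | sum I p ih => simp [Term.mapConst, ih]

theorem Term.mapConst_id (p : Term Act K) : p.mapConst id = p := by
  induction p with
  | unit => rfl
  | const A => rfl
  | pre m p ih => simp [Term.mapConst, ih]
  | sum I p ih => simp [Term.mapConst, ih]

/-- The external sum of a countable family of terms. -/
noncomputable def countableSum {ι : Type*} [Countable ι] (f : ι → Term Act K) : Term Act K :=
  Term.sum (Set.range (exists_injective_nat ι).choose) (fun i =>
    f ((Equiv.ofInjective _ (exists_injective_nat ι).choose_spec).symm i))

theorem mapConst_countableSum {L : Type*} {ι : Type*} [Countable ι] (g : K → L)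
    (f : ι → Term Act K) :
    (countableSum f).mapConst g = countableSum (fun i => (f i).mapConst g) := rfl

variable {co : Act → Act} {defs : K → Term Act K}

theorem step_sum_iff {I : Set ℕ} {p : I → Term Act K} {l : Label Act} {p' : Term Act K} :
    Step defs (.sum I p) l p' ↔ ∃ i, Step defs (p i) l p' := by
  constructor
  · intro h
    cases h with
    | sum _ _ i _ _ h => exact ⟨i, h⟩
  · rintro ⟨i, h⟩
    exact .sum I p i l p' h

theorem step_const_iff {A : K} {l : Label Act} {p' : Term Act K} :
    Step defs (.const A) l p' ↔ Step defs (defs A) l p' := by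
  constructor
  · intro h
    cases h with
    | const _ _ _ h => exact h
  · exact .const A l p'

theorem step_pre_iff {m : ActTau Act} {p p' : Term Act K} {l : Label Act} :
    Step defs (.pre m p) l p' ↔ l = .mu m ∧ p' = p := by
  constructor
  · intro h
    cases h with
    | pre => exact ⟨rfl, rfl⟩
  · rintro ⟨rfl, rfl⟩
    exact .pre m _

theorem step_countableSum_iff {ι : Type*} [Countable ι] {f : ι → Term Act K} {l : Label Act}
    {p' : Term Act K} : Step defs (countableSum f) l p' ↔ ∃ i, Step defs (f i) l p' := by
  rw [countableSum, step_sum_iff]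
  exact (Equiv.ofInjective _ (exists_injective_nat ι).choose_spec).symm.exists_congr_left.trans
    (by simp)

theorem step_intSum_iff {X : Set (Term Act K)} {hX : X.Countable} {l : Label Act}
    {p' : Term Act K} : Step defs (intSum X hX) l p' ↔ l = .tau ∧ p' ∈ X := by
  have : Countable X := hX.to_subtype
  have : intSum X hX = countableSum (fun x : X => Term.pre .tau x.1) := rfl
  rw [this, step_countableSum_iff]
  simp only [step_pre_iff]
  constructor
  · rintro ⟨i, rfl, rfl⟩
    exact ⟨rfl, i.2⟩
  · rintro ⟨rfl, h⟩
    exact ⟨⟨p', h⟩, rfl, rfl⟩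

theorem countable_readySet (p : Term Act K) : (readySet defs p).Countable := by
  have hc : ∀ x : Term Act K, (components defs x).Countable := by
    intro x
    cases x with
    | unit => exact Set.countable_empty
    | const A => exact Set.countable_singleton _
    | pre m p => exact Set.countable_empty
    | sum I p => exact Set.countable_range p
  have key : ∀ (l : Label Act) (p' : Term Act K), Step defs p l p' → ∀ a, l = .act a →
      ∃ q, Term.pre (.act a) q ∈
        {y | Relation.ReflTransGen (fun x y => y ∈ components defs x) p y} := by
    intro l p' h
    induction h with
    | ok => intro a h; cases h
    | pre m p => rintro a h; cases h; exact ⟨p, .refl⟩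
    | sum I p i l p' _ ih =>
      intro a h
      obtain ⟨q, hq⟩ := ih a h
      exact ⟨q, .head (Set.mem_range_self i) hq⟩
    | const A l p' _ ih =>
      intro a h
      obtain ⟨q, hq⟩ := ih a h
      exact ⟨q, .head (Set.mem_singleton _) hq⟩
  have h1 := (countable_reach (components defs) hc p).image (fun q => match q with
    | .pre (.act a) _ => some a
    | _ => (none : Option Act))
  refine (h1.preimage (Option.some_injective Act)).mono ?_
  rintro a ⟨p', h⟩
  obtain ⟨q, hq⟩ := key _ _ h a rfl
  exact ⟨_, hq, rfl⟩

/-! Weak traces. -/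

variable (defs) in
/-- `Weak defs p s q`: the process `p` can perform the weak trace `s` and end in `q`. -/
inductive Weak : Term Act K → List Act → Term Act K → Prop
  | refl (p : Term Act K) : Weak p [] p
  | act (p p' q : Term Act K) (a : Act) (s : List Act) :
      Weak p' s q → Step defs p (.act a) p' → Weak p (a :: s) q
  | tau (p p' q : Term Act K) (s : List Act) :
      Weak p' s q → Step defs p .tau p' → Weak p s q

theorem Weak.append {p q r : Term Act K} {s t : List Act} (h : Weak defs p s q)
    (h' : Weak defs q t r) : Weak defs p (s ++ t) r := by
  induction h with
  | refl p => exact h'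
  | act p p' q a s _ h2 ih => exact .act p p' r a _ (ih h') h2
  | tau p p' q s _ h2 ih => exact .tau p p' r _ (ih h') h2

theorem Weak.exists_of_append {p r : Term Act K} {s t : List Act}
    (h : Weak defs p (s ++ t) r) : ∃ q, Weak defs p s q ∧ Weak defs q t r := by
  generalize hu : s ++ t = u at h
  induction h generalizing s with
  | refl p =>
    obtain ⟨rfl, rfl⟩ := List.append_eq_nil_iff.1 hu
    exact ⟨p, .refl p, .refl p⟩
  | act p p' q a u h1 h2 ih =>
    cases s with
    | nil => exact ⟨p, .refl p, by simp only [List.nil_append] at hu; exact hu ▸ .act p p' q a u h1 h2⟩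
    | cons b s =>
      obtain ⟨rfl, h⟩ := List.cons.inj hu
      obtain ⟨q', h3, h4⟩ := ih h
      exact ⟨q', .act p p' q' _ s h3 h2, h4⟩
  | tau p p' q u _ h2 ih =>
    obtain ⟨q', h3, h4⟩ := ih hu
    exact ⟨q', .tau p p' q' s h3 h2, h4⟩

theorem Weak.exists_of_cons {p r : Term Act K} {a : Act} {s : List Act}
    (h : Weak defs p (a :: s) r) :
    ∃ p₁ p₂, Weak defs p [] p₁ ∧ Step defs p₁ (.act a) p₂ ∧ Weak defs p₂ s r := by
  generalize hu : a :: s = u at h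
  induction h with
  | refl p => cases hu
  | act p p' q b u h1 h2 ih =>
    obtain ⟨rfl, rfl⟩ := List.cons.inj hu
    exact ⟨p, p', .refl p, h2, h1⟩
  | tau p p' q u _ h2 ih =>
    obtain ⟨p₁, p₂, h3, h4⟩ := ih hu
    exact ⟨p₁, p₂, .tau p p' p₁ _ h3 h2, h4⟩

theorem UWT.not_canOk_right {p q : Term Act K} {s : List Act} (h : UWT defs p s q) :
    ¬ CanOk defs q := by
  induction h <;> assumption

theorem UWT.append {p q r : Term Act K} {s t : List Act} (h : UWT defs p s q)
    (h' : UWT defs q t r) : UWT defs p (s ++ t) r := by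
  induction h with
  | refl p _ => exact h'
  | act p p' q a s _ hp h2 ih => exact .act p p' r a _ (ih h') hp h2
  | tau p p' q s _ hp h2 ih => exact .tau p p' r _ (ih h') hp h2

theorem UWT.exists_of_append {p r : Term Act K} {s t : List Act}
    (h : UWT defs p (s ++ t) r) : ∃ q, UWT defs p s q ∧ UWT defs q t r := by
  generalize hu : s ++ t = u at h
  induction h generalizing s with
  | refl p hp =>
    obtain ⟨rfl, rfl⟩ := List.append_eq_nil_iff.1 hu
    exact ⟨p, .refl p hp, .refl p hp⟩
  | act p p' q a u h1 hp h2 ih =>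
    cases s with
    | nil =>
      simp only [List.nil_append] at hu
      exact ⟨p, .refl p hp, hu ▸ .act p p' q a u h1 hp h2⟩
    | cons b s =>
      obtain ⟨rfl, h⟩ := List.cons.inj hu
      obtain ⟨q', h3, h4⟩ := ih h
      exact ⟨q', .act p p' q' _ s h3 hp h2, h4⟩
  | tau p p' q u _ hp h2 ih =>
    obtain ⟨q', h3, h4⟩ := ih hu
    exact ⟨q', .tau p p' q' s h3 hp h2, h4⟩

theorem uwt_cons_iff {p r : Term Act K} {a : Act} {s : List Act} :
    UWT defs p (a :: s) r ↔ ∃ q, UWT defs p [a] q ∧ UWT defs q s r :=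
  ⟨fun h => UWT.exists_of_append (s := [a]) h, fun ⟨_, h1, h2⟩ => h1.append h2⟩

theorem not_canOk_intSum {X : Set (Term Act K)} {hX : X.Countable} :
    ¬ CanOk defs (intSum X hX) := by
  rintro ⟨r', h⟩
  cases (step_intSum_iff.1 h).1

theorem uwt_intSum_iff {X : Set (Term Act K)} {hX : X.Countable} {s : List Act}
    {q : Term Act K} :
    UWT defs (intSum X hX) s q ↔ (s = [] ∧ q = intSum X hX) ∨ ∃ x ∈ X, UWT defs x s q := by
  constructor
  · intro h
    cases h with
    | refl => exact .inl ⟨rfl, rfl⟩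
    | act _ p' _ a s _ _ h => cases (step_intSum_iff.1 h).1
    | tau _ p' _ _ h1 _ h => exact .inr ⟨p', (step_intSum_iff.1 h).2, h1⟩
  · rintro (⟨rfl, rfl⟩ | ⟨x, hx, h⟩)
    · exact .refl _ not_canOk_intSum
    · exact .tau _ x q s h not_canOk_intSum (step_intSum_iff.2 ⟨rfl, hx⟩)

/-! The inductive description of `Must`. -/

variable (co defs) in
/-- The inductive characterisation of `Must`. -/
inductive MustI : Term Act K × Term Act K → Prop
  | ok (x : Term Act K × Term Act K) : CanOk defs x.2 → MustI x
  | step (x y : Term Act K × Term Act K) : ParStep co defs x .tau y →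
      (∀ z, ParStep co defs x .tau z → MustI z) → MustI x

theorem MustI.exists_canOk {x : Term Act K × Term Act K} (h : MustI co defs x) :
    ∀ (N : ℕ∞) (c : ℕ → Term Act K × Term Act K), c 0 = x → IsMaximalComputation co defs N c →
      ∃ k : ℕ, (k : ℕ∞) ≤ N ∧ CanOk defs (c k).2 := by
  induction h with
  | ok x h =>
    rintro N c rfl -
    exact ⟨0, by simp, h⟩
  | step x y hy _ ih =>
    rintro N c rfl ⟨h1, h2⟩
    have hN : N ≠ 0 := fun h => h2 0 h ⟨y, hy⟩
    have hstep := h1 0 (by simpa using pos_iff_ne_zero.2 hN)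
    obtain ⟨M, rfl⟩ : ∃ M, N = M + 1 :=
      ⟨N - 1, (tsub_add_cancel_of_le (Order.one_le_iff_ne_zero.2 hN)).symm⟩
    have hmax : IsMaximalComputation co defs M (fun n => c (n + 1)) := by
      refine ⟨fun k hk => h1 (k + 1) ?_, ?_⟩
      · push_cast
        exact (ENat.add_lt_add_iff_right ENat.one_ne_top).2 hk
      · rintro n rfl
        exact h2 (n + 1) (by push_cast; rfl)
    obtain ⟨k, hk, hok⟩ := ih (c 1) hstep M (fun n => c (n + 1)) rfl hmax
    exact ⟨k + 1, by push_cast; gcongr, hok⟩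

theorem must_iff {p r : Term Act K} : Must co defs p r ↔ MustI co defs (p, r) := by
  classical
  refine ⟨fun h => ?_, fun h N c => h.exists_canOk N c⟩
  by_contra hn
  -- A failing state without failing successor is a deadlock, so always moving to a failing
  -- successor produces a maximal computation.
  let S : Term Act K × Term Act K → Prop :=
    fun x => ∃ y, ParStep co defs x .tau y ∧ ¬ MustI co defs y
  let next : Term Act K × Term Act K → Term Act K × Term Act K :=
    fun x => if h : S x then h.choose else x
  have hnext : ∀ x, S x → ParStep co defs x .tau (next x) ∧ ¬ MustI co defs (next x) := by
    intro x hx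
    simp only [next, hx, dif_pos]
    exact hx.choose_spec
  have hbad : ∀ x, ¬ MustI co defs x → ¬ MustI co defs (next x) := by
    intro x hx
    by_cases hS : S x
    · exact (hnext x hS).2
    · simpa [next, hS] using hx
  have hdead : ∀ x, ¬ MustI co defs x → ¬ S x → ¬ ∃ y, ParStep co defs x .tau y := by
    rintro x hx hS ⟨y, hy⟩
    refine hx (.step x y hy fun z hz => ?_)
    by_contra hz'
    exact hS ⟨z, hz, hz'⟩
  let c : ℕ → Term Act K × Term Act K := fun n => next^[n] (p, r)
  have hc : ∀ n, c (n + 1) = next (c n) := fun n => Function.iterate_succ_apply' next n _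
  have hcb : ∀ n, ¬ MustI co defs (c n) := by
    intro n
    induction n with
    | zero => exact hn
    | succ n ih => rw [hc]; exact hbad _ ih
  suffices ∃ N, IsMaximalComputation co defs N c by
    obtain ⟨N, hN⟩ := this
    obtain ⟨k, -, hk⟩ := h N c rfl hN
    exact hcb k (.ok _ hk)
  -- The computation ends at the first state without failing successor; if there is none, it is
  -- infinite.
  by_cases hE : ∃ n, ¬ S (c n)
  · refine ⟨(Nat.find hE : ℕ), fun k hk => ?_, fun n hN => ?_⟩
    · rw [hc]
      exact (hnext _ (not_not.1 (Nat.find_min hE (by exact_mod_cast hk)))).1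
    · have : Nat.find hE = n := by exact_mod_cast hN
      exact this ▸ hdead _ (hcb _) (Nat.find_spec hE)
  · push Not at hE
    refine ⟨⊤, fun k _ => ?_, fun n hN => by simp at hN⟩
    rw [hc]
    exact (hnext _ (hE k)).1

/-- Synchronisations are indexed by the client's action, so that traces of clients stay
uncomplemented. -/
theorem parStep_tau_iff (hco : Function.Involutive co) {p r : Term Act K}
    {x : Term Act K × Term Act K} : ParStep co defs (p, r) .tau x ↔
      (∃ p', Step defs p .tau p' ∧ x = (p', r)) ∨ (∃ r', Step defs r .tau r' ∧ x = (p, r')) ∨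
      ∃ a p' r', Step defs p (.act (co a)) p' ∧ Step defs r (.act a) r' ∧ x = (p', r') := by
  constructor
  · intro h
    cases h with
    | left _ p' _ _ h => exact .inl ⟨p', h, rfl⟩
    | right _ _ r' _ h => exact .inr (.inl ⟨r', h, rfl⟩)
    | synch _ p' _ r' a h1 h2 => exact .inr (.inr ⟨co a, p', r', by rwa [hco a], h2, rfl⟩)
  · rintro (⟨p', h, rfl⟩ | ⟨r', h, rfl⟩ | ⟨a, p', r', h1, h2, rfl⟩)
    · exact .left p p' r _ h
    · exact .right p r r' _ h
    · exact .synch p p' r r' (co a) h1 (by rwa [hco a])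

/-! ### Consequences of `MustI` along unsuccessful computations. -/

variable (co defs) in
/-- A `τ` transition of a composition whose client cannot report success. -/
def UStep (x y : Term Act K × Term Act K) : Prop :=
  ¬ CanOk defs x.2 ∧ ParStep co defs x .tau y

theorem MustI.of_uStep {x y : Term Act K × Term Act K} (h : MustI co defs x)
    (hxy : UStep co defs x y) : MustI co defs y := by
  cases h with
  | ok _ h => exact absurd h hxy.1
  | step _ _ _ h => exact h y hxy.2

theorem MustI.of_uSteps {x y : Term Act K × Term Act K} (h : MustI co defs x)
    (hxy : Relation.ReflTransGen (UStep co defs) x y) : MustI co defs y := by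
  induction hxy with
  | refl => exact h
  | tail _ h' ih => exact ih.of_uStep h'

theorem MustI.acc {x : Term Act K × Term Act K} (h : MustI co defs x) :
    Acc (flip (UStep co defs)) x := by
  induction h with
  | ok x h => exact ⟨_, fun y hy => absurd h hy.1⟩
  | step x _ _ _ ih => exact ⟨_, fun y hy => ih y hy.2⟩

theorem MustI.exists_parStep {x : Term Act K × Term Act K} (h : MustI co defs x)
    (hx : ¬ CanOk defs x.2) : ∃ y, ParStep co defs x .tau y := by
  cases h with
  | ok _ h => exact absurd h hx
  | step _ y h _ => exact ⟨y, h⟩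

theorem Weak.uSteps {p p' r : Term Act K} (h : Weak defs p [] p') (hr : ¬ CanOk defs r) :
    Relation.ReflTransGen (UStep co defs) (p, r) (p', r) := by
  generalize hs : ([] : List Act) = s at h
  induction h with
  | refl p => exact .refl
  | act => cases hs
  | tau p p' q s _ h ih => exact .head ⟨hr, .left p p' r _ h⟩ (ih hs)

theorem UWT.uSteps (hco : Function.Involutive co) {r r' : Term Act K} {s : List Act}
    (h : UWT defs r s r') {p p' : Term Act K} (hp : Weak defs p (s.map co) p') :
    Relation.ReflTransGen (UStep co defs) (p, r) (p', r') := by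
  induction h generalizing p with
  | refl r hr => exact hp.uSteps hr
  | act r r₁ r₂ a s _ hr h2 ih =>
    obtain ⟨p₁, p₂, h3, h4, h5⟩ := Weak.exists_of_cons hp
    exact (h3.uSteps hr).trans
      (.head ⟨hr, (parStep_tau_iff hco).2 (.inr (.inr ⟨a, p₂, r₁, h4, h2, rfl⟩))⟩ (ih h5))
  | tau r r₁ r₂ s _ hr h2 ih => exact .head ⟨hr, .right p r r₁ _ h2⟩ (ih hp)

/-- The visible action forces at least one step; this strictness yields the infinite descent in
`MustI.not_seq`. -/
theorem UWT.uSteps_cons (hco : Function.Involutive co) {r r' : Term Act K} {a : Act}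
    (h : UWT defs r [a] r') {p p' : Term Act K} (hp : Weak defs p [co a] p') :
    Relation.TransGen (UStep co defs) (p, r) (p', r') := by
  generalize hs : [a] = s at h
  induction h with
  | refl => cases hs
  | act r r₁ r₂ a s h1 hr h2 ih =>
    cases hs
    obtain ⟨p₁, p₂, h3, h4, h5⟩ := Weak.exists_of_cons hp
    exact (Relation.TransGen.head' (b := (p₂, r₁))
      ⟨hr, (parStep_tau_iff hco).2 (.inr (.inr ⟨_, p₂, r₁, h4, h2, rfl⟩))⟩
      (h1.uSteps hco h5)).trans_right (h3.uSteps hr)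
  | tau r r₁ r₂ s _ hr h2 ih => exact .head ⟨hr, .right p r r₁ _ h2⟩ (ih hs)

theorem MustI.of_traces (hco : Function.Involutive co) {p p' r r' : Term Act K} {s : List Act}
    (h : MustI co defs (p, r)) (hp : Weak defs p (s.map co) p') (hr : UWT defs r s r') :
    MustI co defs (p', r') :=
  h.of_uSteps (hr.uSteps hco hp)

/-- While the server moves alone the client stays at the unsuccessful `r`, so a divergent server
would fail. -/
theorem MustI.acc_server {p r : Term Act K} (h : MustI co defs (p, r)) (hr : ¬ CanOk defs r) :
    Acc (fun y x => Step defs x .tau y) p := by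
  generalize hx : (p, r) = x at h
  induction h generalizing p with
  | ok x h => subst hx; exact absurd h hr
  | step x _ _ _ ih =>
    subst hx
    exact ⟨_, fun p' h => ih (p', r) (.left p p' r _ h) rfl⟩

theorem MustI.acc_client {p r : Term Act K} (h : MustI co defs (p, r)) :
    Acc (fun y x => ¬ CanOk defs x ∧ Step defs x .tau y) r := by
  generalize hx : (p, r) = x at h
  induction h generalizing r with
  | ok x h => subst hx; exact ⟨_, fun y hy => absurd h hy.1⟩
  | step x _ _ _ ih =>
    subst hx
    exact ⟨_, fun r' h => ih (p, r') (.right p r r' _ h.2) rfl⟩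

/-- Lexicographic induction on the convergence of server and client: silent moves terminate, `hd`
excludes deadlock, and `hs` covers the pairs after the first synchronisation. It localises the
causes of failure. -/
theorem MustI.of_convergent (hco : Function.Involutive co) {p r : Term Act K}
    (hp : Acc (fun y x => Step defs x .tau y) p)
    (hr : Acc (fun y x => ¬ CanOk defs x ∧ Step defs x .tau y) r)
    (hd : ∀ p' r', Weak defs p [] p' → UWT defs r [] r' → Stable defs p' → Stable defs r' →
      ∃ x, ParStep co defs (p', r') .tau x)
    (hs : ∀ a p' r', Weak defs p [co a] p' → UWT defs r [a] r' → MustI co defs (p', r')) :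
    MustI co defs (p, r) := by
  induction hp generalizing r with
  | intro p hp ihp =>
    induction hr with
    | intro r hr ihr =>
      by_cases hok : CanOk defs r
      · exact .ok _ hok
      have key : ∀ z, ParStep co defs (p, r) .tau z → MustI co defs z := by
        intro z hz
        rcases (parStep_tau_iff hco).1 hz with ⟨p', h, rfl⟩ | ⟨r', h, rfl⟩ | ⟨a, p', r', h1, h2, rfl⟩
        · exact ihp p' h ⟨r, hr⟩ (fun p₁ r₁ h1 h2 => hd p₁ r₁ (.tau _ _ _ _ h1 h) h2)
            (fun a p₁ r₁ h1 h2 => hs a p₁ r₁ (.tau _ _ _ _ h1 h) h2)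
        · exact ihr r' ⟨hok, h⟩ (fun p₁ r₁ h1 h2 => hd p₁ r₁ h1 (.tau _ _ _ _ h2 hok h))
            (fun a p₁ r₁ h1 h2 => hs a p₁ r₁ h1 (.tau _ _ _ _ h2 hok h))
        · by_cases hok' : CanOk defs r'
          · exact .ok _ hok'
          · exact hs a p' r' (.act _ _ _ _ _ (.refl _) h1) (.act _ _ _ _ _ (.refl _ hok') hok h2)
      suffices ∃ y, ParStep co defs (p, r) .tau y by
        obtain ⟨y, hy⟩ := this
        exact .step _ y hy key
      by_cases h1 : Stable defs p
      · by_cases h2 : Stable defs r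
        · exact hd p r (.refl p) (.refl r hok) h1 h2
        · obtain ⟨r', h⟩ := not_not.1 h2
          exact ⟨_, .right p r r' _ h⟩
      · obtain ⟨p', h⟩ := not_not.1 h1
        exact ⟨_, .left p p' r _ h⟩

/-! ### Usability along traces. -/

theorem MustI.intSum {p : Term Act K} {X : Set (Term Act K)} {hX : X.Countable}
    (hco : Function.Involutive co) (hne : X.Nonempty) (hok : ∀ x ∈ X, ¬ CanOk defs x)
    (h : ∀ x ∈ X, MustI co defs (p, x)) : MustI co defs (p, intSum X hX) := by
  obtain ⟨x₀, hx₀⟩ := hne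
  -- The sum never synchronises, so only an infinite silent run of the server could delay its choice
  -- forever.
  have hp := (h x₀ hx₀).acc_server (hok x₀ hx₀)
  induction hp with
  | intro p _ ih =>
    refine .step _ (p, x₀) (.right _ _ _ _ (step_intSum_iff.2 ⟨rfl, hx₀⟩)) fun z hz => ?_
    rcases (parStep_tau_iff hco).1 hz with ⟨p', h1, rfl⟩ | ⟨r', h1, rfl⟩ | ⟨a, p', r', _, h1, rfl⟩
    · exact ih p' h1 fun x hx => (h x hx).of_uStep ⟨hok x hx, .left _ _ _ _ h1⟩
    · exact h r' (step_intSum_iff.1 h1).2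
    · cases (step_intSum_iff.1 h1).1

/-- A client is usable along `s` exactly when, for each prefix of `s`, one server satisfies all
its residuals after that prefix. -/
theorem usableAlong_iff (hco : Function.Involutive co) {r : Term Act K} {s : List Act} :
    UsableAlong co defs r s ↔
      ∀ s', s' <+: s → ∃ p, ∀ q, UWT defs r s' q → MustI co defs (p, q) := by
  have hnil : ∀ r : Term Act K,
      Usable co defs r ↔ ∃ p, ∀ q, UWT defs r [] q → MustI co defs (p, q) := by
    intro r
    simp only [Usable, must_iff]
    refine exists_congr fun p => ⟨fun h q hq => h.of_traces hco (.refl p) hq, fun h => ?_⟩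
    by_cases hok : CanOk defs r
    · exact .ok _ hok
    · exact h r (.refl r hok)
  induction s generalizing r with
  | nil =>
    rw [UsableAlong, hnil]
    simp
  | cons a s ih =>
    rw [UsableAlong, hnil]
    refine (and_congr_right fun _ => imp_congr_right fun _ => ih).trans ?_
    constructor
    · rintro ⟨h0, h1⟩ s' hs'
      cases s' with
      | nil => exact h0
      | cons b s' =>
        obtain ⟨rfl, hpre⟩ := List.cons_prefix_cons.1 hs'
        by_cases hc : CanUWT defs r [b]
        · obtain ⟨p, hp⟩ := h1 hc s' hpre
          refine ⟨p, fun q hq => hp q ?_⟩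
          obtain ⟨q', h2, h3⟩ := uwt_cons_iff.1 hq
          exact uwt_intSum_iff.2 (.inr ⟨q', h2, h3⟩)
        · refine ⟨.nil, fun q hq => ?_⟩
          obtain ⟨q', h2, _⟩ := uwt_cons_iff.1 hq
          exact absurd ⟨q', h2⟩ hc
    · intro h
      refine ⟨h [] (List.nil_prefix), fun hc s' hs' => ?_⟩
      obtain ⟨p, hp⟩ := h (a :: s') (List.cons_prefix_cons.2 ⟨rfl, hs'⟩)
      refine ⟨p, fun q hq => ?_⟩
      -- After the empty trace the sum itself is an extra residual, handled by `MustI.intSum`.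
      rcases uwt_intSum_iff.1 hq with ⟨rfl, rfl⟩ | ⟨x, hx, h2⟩
      · exact .intSum hco hc (fun x hx => UWT.not_canOk_right hx) (fun x hx => hp x hx)
      · exact hp q (uwt_cons_iff.2 ⟨x, hx, h2⟩)

/-- The derivatives of `p` along prefixes of the trace are the required servers. -/
theorem MustI.usableAlong (hco : Function.Involutive co) {p p' r : Term Act K} {s : List Act}
    (h : MustI co defs (p, r)) (hp : Weak defs p (s.map co) p') : UsableAlong co defs r s := by
  refine (usableAlong_iff hco).2 ?_
  rintro s' ⟨t, rfl⟩
  rw [List.map_append] at hp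
  obtain ⟨p₁, h1, -⟩ := hp.exists_of_append
  exact ⟨p₁, fun q hq => h.of_traces hco h1 hq⟩

/-! Infinite traces. -/

theorem uwt_of_run {t : ℕ → ActTau Act} {q : ℕ → Term Act K}
    (hstep : ∀ i, Step defs (q i) (.mu (t i)) (q (i + 1))) (hok : ∀ i, ¬ CanOk defs (q i)) (k : ℕ) :
    UWT defs (q 0) (visible (takePrefix t k)) (q k) := by
  induction k with
  | zero => exact .refl _ (hok 0)
  | succ k ih =>
    rw [takePrefix_succ, visible_append]
    refine ih.append ?_
    have h := hstep k
    cases ht : t k with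
    | tau => rw [ht] at h; exact .tau _ _ _ _ (.refl _ (hok _)) (hok k) h
    | act a => rw [ht] at h; exact .act _ _ _ _ _ (.refl _ (hok _)) (hok k) h

theorem CanUWTInf.exists_tail {r : Term Act K} {w : ℕ → Act} (h : CanUWTInf defs r w) :
    ∃ r', UWT defs r [w 0] r' ∧ CanUWTInf defs r' (fun n => w (n + 1)) := by
  obtain ⟨t, q, rfl, hstep, hok, hv⟩ := h
  obtain ⟨k, hk⟩ := hv 1
  have hk' : [w 0] = visible (takePrefix t k) := hk
  refine ⟨q k, hk' ▸ uwt_of_run hstep hok k, fun i => t (k + i), fun i => q (k + i), rfl,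
    fun i => hstep _, fun i => hok _, fun n => ?_⟩
  obtain ⟨m, hm⟩ := hv (1 + n)
  rcases le_total k m with hkm | hkm
  · obtain ⟨j, rfl⟩ := Nat.exists_eq_add_of_le hkm
    rw [takePrefix_add, takePrefix_add t, visible_append, ← hk] at hm
    refine ⟨j, ?_⟩
    simpa only [add_comm 1] using List.append_cancel_left hm
  -- Here `1 + n` visible actions occur within a run showing only one, so `n = 0`.
  · obtain ⟨j, rfl⟩ := Nat.exists_eq_add_of_le hkm
    rw [takePrefix_add t, visible_append, ← hm] at hk
    have := congrArg List.length hk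
    rw [List.length_append, takePrefix_length, takePrefix_length] at this
    obtain rfl : n = 0 := by omega
    exact ⟨0, rfl⟩

theorem CanUWTInf.exists_seq {r : Term Act K} {w : ℕ → Act} (h : CanUWTInf defs r w) :
    ∃ q : ℕ → Term Act K, q 0 = r ∧ ∀ n, UWT defs (q n) [w n] (q (n + 1)) := by
  obtain ⟨f, h0, hf⟩ := exists_seq_of_step (x := ((0 : ℕ), r))
    (P := fun x => CanUWTInf defs x.2 (fun n => w (n + x.1)))
    (R := fun x y => y.1 = x.1 + 1 ∧ UWT defs x.2 [w x.1] y.2) h (by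
      rintro ⟨n, x⟩ hx
      obtain ⟨x', h1, h2⟩ := CanUWTInf.exists_tail hx
      refine ⟨(n + 1, x'), ⟨rfl, by simpa using h1⟩, ?_⟩
      simpa only [add_assoc, add_comm 1] using h2)
  have hn : ∀ n, (f n).1 = n := by
    intro n
    induction n with
    | zero => rw [h0]
    | succ n ih => rw [(hf n).2.1, ih]
  refine ⟨fun n => (f n).2, by simp [h0], fun n => ?_⟩
  have := (hf n).2.2
  rwa [hn] at this

variable (defs) in
/-- `UWTSteps defs k p a q`: a derivation of `UWT defs p [a] q` with `k` silent steps before the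
visible action. -/
def UWTSteps : ℕ → Term Act K → Act → Term Act K → Prop
  | 0, p, a, q => ¬ CanOk defs p ∧ ∃ p', Step defs p (.act a) p' ∧ UWT defs p' [] q
  | k + 1, p, a, q => ¬ CanOk defs p ∧ ∃ p', Step defs p .tau p' ∧ UWTSteps k p' a q

theorem UWT.exists_steps {p q : Term Act K} {a : Act} (h : UWT defs p [a] q) :
    ∃ k, UWTSteps defs k p a q := by
  generalize hs : [a] = s at h
  induction h with
  | refl => cases hs
  | act p p' q b s h1 hp h2 => cases hs; exact ⟨0, hp, p', h2, h1⟩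
  | tau p p' q s _ hp h2 ih =>
    obtain ⟨k, hk⟩ := ih hs
    exact ⟨k + 1, hp, p', h2, hk⟩

theorem canUWTInf_of_seq {w : ℕ → Act} {q : ℕ → Term Act K}
    (h : ∀ n, UWT defs (q n) [w n] (q (n + 1))) : CanUWTInf defs (q 0) w := by
  -- A state records the number of visible actions performed, the number of silent steps left
  -- before the next one, and the current process.
  obtain ⟨k₀, hk₀⟩ := (h 0).exists_steps
  obtain ⟨f, h0, hf⟩ := exists_seq_of_step (x := ((0 : ℕ), k₀, q 0))
    (P := fun x => UWTSteps defs x.2.1 x.2.2 (w x.1) (q (x.1 + 1)))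
    (R := fun x y => (y.1 = x.1 ∧ x.2.1 = y.2.1 + 1 ∧ Step defs x.2.2 .tau y.2.2) ∨
      (y.1 = x.1 + 1 ∧ Step defs x.2.2 (.act (w x.1)) y.2.2)) hk₀ (by
      rintro ⟨n, k, x⟩ hx
      cases k with
      | zero =>
        obtain ⟨-, x', h1, h2⟩ := hx
        -- The silent tail left after the visible action is prepended to the next segment.
        obtain ⟨k, hk⟩ := (h2.append (h (n + 1))).exists_steps
        exact ⟨(n + 1, k, x'), .inr ⟨rfl, h1⟩, hk⟩
      | succ k =>
        obtain ⟨-, x', h1, h2⟩ := hx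
        exact ⟨(n, k, x'), .inl ⟨rfl, rfl, h1⟩, h2⟩)
  have hlab : ∀ i, ∃ m : ActTau Act, Step defs (f i).2.2 (.mu m) (f (i + 1)).2.2 ∧
      takePrefix w (f (i + 1)).1 = takePrefix w (f i).1 ++ visible [m] := by
    intro i
    rcases (hf i).2 with ⟨h1, -, h2⟩ | ⟨h1, h2⟩
    · exact ⟨_, h2, by rw [h1]; simp [visible]⟩
    · exact ⟨_, h2, by rw [h1, takePrefix_succ]; simp [visible]⟩
  choose t ht htw using hlab
  refine ⟨t, fun i => (f i).2.2, by simp [h0], ht, fun i => ?_, ?_⟩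
  · have := (hf i).1
    revert this
    cases (f i).2.1 <;> exact fun h => h.1
  have hvis : ∀ i, visible (takePrefix t i) = takePrefix w (f i).1 := by
    intro i
    induction i with
    | zero => rw [h0]; rfl
    | succ i ih => rw [takePrefix_succ, visible_append, ih, htw]
  -- The counter of remaining silent steps decreases, so every visible action is eventually reached.
  have hprog : ∀ k i, (f i).2.1 = k → ∃ j, (f j).1 = (f i).1 + 1 := by
    intro k
    induction k with
    | zero =>
      intro i hi
      rcases (hf i).2 with ⟨-, h2, -⟩ | ⟨h1, -⟩
      · omega
      · exact ⟨i + 1, h1⟩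
    | succ k ih =>
      intro i hi
      rcases (hf i).2 with ⟨h1, h2, -⟩ | ⟨h1, -⟩
      · rw [← h1]
        exact ih (i + 1) (by omega)
      · exact ⟨i + 1, h1⟩
  intro n
  suffices ∃ i, (f i).1 = n by
    obtain ⟨i, rfl⟩ := this
    exact ⟨i, (hvis i).symm⟩
  induction n with
  | zero => exact ⟨0, by rw [h0]⟩
  | succ n ih =>
    obtain ⟨i, rfl⟩ := ih
    exact hprog _ i rfl

theorem MustI.not_seq (hco : Function.Involutive co) {p q : ℕ → Term Act K} {w : ℕ → Act}
    (h : MustI co defs (p 0, q 0)) (hp : ∀ n, Weak defs (p n) [co (w n)] (p (n + 1)))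
    (hq : ∀ n, UWT defs (q n) [w n] (q (n + 1))) : False := by
  refine not_acc_of_descending (Acc.transGen h.acc) (fun n => (p n, q n)) rfl fun n => ?_
  exact Relation.transGen_swap.2 ((hq n).uSteps_cons hco (hp n))

/-! Soundness. -/

theorem SemanticClientPreorder.clientPreorder (hco : Function.Involutive co)
    {r₁ r₂ : Term Act K} (h : SemanticClientPreorder co defs r₁ r₂) :
    ClientPreorder co defs r₁ r₂ := by
  obtain ⟨hacc, hfin, hinf⟩ := h
  intro p hp
  rw [must_iff] at hp ⊢
  by_contra hn
  have hok : ¬ CanOk defs r₂ := fun h => hn (.ok _ h)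
  obtain ⟨f, h0, hf⟩ := exists_seq_of_step (x := (([] : List Act), p, r₂))
    (P := fun x => Weak defs p (x.1.map co) x.2.1 ∧ UWT defs r₂ x.1 x.2.2 ∧ ¬ MustI co defs x.2)
    (R := fun x y => ∃ a, y.1 = x.1 ++ [a] ∧ Weak defs x.2.1 [co a] y.2.1 ∧
      UWT defs x.2.2 [a] y.2.2) ⟨.refl p, .refl _ hok, hn⟩ (by
      rintro ⟨s, p', r'⟩ ⟨h1, h2, h3⟩
      dsimp only at h1 h2 h3
      -- If no failing pair follows after one more visible action, the current pair satisfies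
      -- `MustI`.
      by_contra hcon
      have hs : UsableAlong co defs r₁ s := hp.usableAlong hco h1
      refine h3 (MustI.of_convergent hco ?_ ?_ ?_ ?_)
      · obtain ⟨q, hq⟩ := hfin s hs ⟨r', h2⟩
        exact (hp.of_traces hco h1 hq).acc_server hq.not_canOk_right
      · obtain ⟨p₁, hp₁⟩ := (usableAlong_iff hco).1 (hacc s hs).1 s List.prefix_rfl
        exact (hp₁ r' h2).acc_client
      · intro p₁ r₃ h4 h5 h6 h7
        have h8 : UWT defs r₂ s r₃ := by simpa using h2.append h5
        have h9 : Weak defs p (s.map co) p₁ := by simpa using h1.append h4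
        obtain ⟨A, ⟨q, hq, hqs, rfl⟩, hA⟩ := (hacc s hs).2 _ ⟨r₃, h8, h7, rfl⟩
        obtain ⟨x, hx⟩ := (hp.of_traces hco h9 hq).exists_parStep hq.not_canOk_right
        rcases (parStep_tau_iff hco).1 hx with ⟨p', h, -⟩ | ⟨q', h, -⟩ | ⟨a, p₂, q', h10, h11, -⟩
        · exact absurd ⟨p', h⟩ h6
        · exact absurd ⟨q', h⟩ hqs
        -- The server itself performs the complement of `s ++ [a]`, which makes `a` a usable action
        -- and lets the acceptance clause apply.
        · have ha : a ∈ usableActions co defs r₁ s := fun _ =>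
            hp.usableAlong hco (p' := p₂) (by
              rw [List.map_append]
              exact h9.append (.act _ _ _ _ _ (.refl _) h10))
          obtain ⟨r₄, h12⟩ := hA ⟨⟨q', h11⟩, ha⟩
          exact ⟨_, (parStep_tau_iff hco).2 (.inr (.inr ⟨a, p₂, r₄, h10, h12, rfl⟩))⟩
      · intro a p₁ r₃ h4 h5
        by_contra h6
        refine hcon ⟨(s ++ [a], p₁, r₃), ⟨a, rfl, h4, h5⟩, ?_, h2.append h5, h6⟩
        rw [List.map_append]
        exact h1.append h4)
  choose w hw using fun n => (hf n).2
  have hpre : ∀ n, (f n).1 = takePrefix w n := by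
    intro n
    induction n with
    | zero => rw [h0]; rfl
    | succ n ih => rw [takePrefix_succ, ← ih, (hw n).1]
  have hus : UsableAlongInf co defs r₁ w := fun n =>
    hp.usableAlong hco (p' := (f n).2.1) (hpre n ▸ (hf n).1.1)
  have hr₂ : CanUWTInf defs r₂ w := by
    have := canUWTInf_of_seq (q := fun n => (f n).2.2) (fun n => (hw n).2.2)
    rwa [h0] at this
  obtain ⟨q, hq0, hq⟩ := (hinf w hus hr₂).exists_seq
  refine MustI.not_seq hco (p := fun n => (f n).2.1) (q := q) ?_ (fun n => (hw n).2.1) hq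
  rwa [h0, hq0]

/-! Completeness. -/

variable (defs) in
/-- `P` can choose silently to behave as `q`, can perform `b` and become `P'`, and can do nothing
else. -/
def IsBranch (P q : Term Act K) (b : Act) (P' : Term Act K) : Prop :=
  ∀ l p, Step defs P l p ↔ (l = .tau ∧ p = q) ∨ (l = .act b ∧ p = P')

/-- The term `τ.q + b.P`. -/
noncomputable def branch (q : Term Act K) (b : Act) (P : Term Act K) : Term Act K :=
  countableSum (fun c : Bool => if c then .pre .tau q else .pre (.act b) P)

theorem isBranch_branch (q : Term Act K) (b : Act) (P : Term Act K) :
    IsBranch defs (branch q b P) q b P := by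
  intro l p
  rw [branch, step_countableSum_iff]
  simp [step_pre_iff, or_comm]

/-- The silent escape to `q` excludes deadlock, and since `q` satisfies `r`, the client cannot
diverge unsuccessfully while the server waits. -/
theorem IsBranch.mustI (hco : Function.Involutive co) {P q P' r : Term Act K} {a : Act}
    (hP : IsBranch defs P q (co a) P') (hq : ¬ CanOk defs r → MustI co defs (q, r))
    (h : ∀ r', UWT defs r [a] r' → MustI co defs (P', r')) : MustI co defs (P, r) := by
  by_cases hok : CanOk defs r
  · exact .ok _ hok
  have hr := (hq hok).acc_client
  induction hr with
  | intro r _ ih =>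
    refine .step _ (q, r) (.left _ _ _ _ ((hP _ _).2 (.inl ⟨rfl, rfl⟩))) fun z hz => ?_
    rcases (parStep_tau_iff hco).1 hz with ⟨p', h1, rfl⟩ | ⟨r', h1, rfl⟩ | ⟨b, p', r', h1, h2, rfl⟩
    · rcases (hP _ _).1 h1 with ⟨-, rfl⟩ | ⟨h2, -⟩
      · exact hq hok
      · cases h2
    · by_cases hok' : CanOk defs r'
      · exact .ok _ hok'
      · exact ih r' ⟨hok, h1⟩ (fun _ => (hq hok).of_uStep ⟨hok, .right _ _ _ _ h1⟩)
          (fun r₁ h2 => h r₁ (.tau _ _ _ _ h2 hok h1)) hok'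
    · rcases (hP _ _).1 h1 with ⟨h3, -⟩ | ⟨h3, rfl⟩
      · cases h3
      · have hab : b = a := hco.injective (by injection h3 with h3; injection h3)
        subst hab
        by_cases hok' : CanOk defs r'
        · exact .ok _ hok'
        · exact h r' (.act _ _ _ _ _ (.refl _ hok') hok h2)

/-- Clients that are usable along `s` are satisfied by a server that can perform the complement
of `s` and then behave as any server satisfying all residuals of the clients after `s`. -/
theorem exists_server_of_trace (hco : Function.Involutive co) {s : List Act}
    {X : Set (Term Act K)} {T : Term Act K}
    (hX : ∀ s', s' <+: s → ∃ p, ∀ x ∈ X, ∀ q, UWT defs x s' q → MustI co defs (p, q))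
    (hT : ∀ x ∈ X, ∀ q, UWT defs x s q → MustI co defs (T, q)) :
    ∃ P, (∀ x ∈ X, MustI co defs (P, x)) ∧ Weak defs P (s.map co) T := by
  induction s generalizing X with
  | nil =>
    refine ⟨T, fun x hx => ?_, .refl T⟩
    by_cases hok : CanOk defs x
    · exact .ok _ hok
    · exact hT x hx x (.refl x hok)
  | cons a s ih =>
    -- One server must handle all `a`-residuals at once, hence the induction over sets of clients.
    obtain ⟨P', h1, h2⟩ := ih (X := {q | ∃ x ∈ X, UWT defs x [a] q})
      (fun s' hs' => by
        obtain ⟨p, hp⟩ := hX (a :: s') (List.cons_prefix_cons.2 ⟨rfl, hs'⟩)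
        refine ⟨p, ?_⟩
        rintro y ⟨x, hx, hxy⟩ q hq
        exact hp x hx q (uwt_cons_iff.2 ⟨y, hxy, hq⟩))
      (by
        rintro y ⟨x, hx, hxy⟩ q hq
        exact hT x hx q (uwt_cons_iff.2 ⟨y, hxy, hq⟩))
    obtain ⟨p, hp⟩ := hX [] List.nil_prefix
    have hb := isBranch_branch (defs := defs) p (co a) P'
    exact ⟨branch p (co a) P', fun x hx => hb.mustI hco (fun hok => hp x hx x (.refl x hok))
      (fun r' hr' => h1 r' ⟨x, hx, hr'⟩), .act _ P' _ _ _ h2 ((hb _ _).2 (.inr ⟨rfl, rfl⟩))⟩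

/-- The test principle of completeness: what satisfies all `s`-residuals of `r₁` satisfies those of
`r₂`. -/
theorem ClientPreorder.mustI_of_trace (hco : Function.Involutive co) {r₁ r₂ : Term Act K}
    (h : ClientPreorder co defs r₁ r₂) {s : List Act} (hs : UsableAlong co defs r₁ s)
    {T : Term Act K} (hT : ∀ q, UWT defs r₁ s q → MustI co defs (T, q)) {q : Term Act K}
    (hq : UWT defs r₂ s q) : MustI co defs (T, q) := by
  obtain ⟨P, h1, h2⟩ := exists_server_of_trace hco (X := {r₁}) (T := T)
    (by simpa using (usableAlong_iff hco).1 hs) (by simpa using hT)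
  have h3 := must_iff.1 (h P (must_iff.2 (h1 r₁ rfl)))
  exact h3.of_traces hco h2 hq

theorem exists_divergent (hdefs : AllowsDefinitions defs) :
    ∃ Ω : Term Act K, Step defs Ω .tau Ω := by
  obtain ⟨A, hA⟩ := hdefs (fun _ => .pre .tau (.const (.inr 0)))
  refine ⟨.const (A 0), step_const_iff.2 ?_⟩
  rw [hA]
  exact .pre _ _

/-- A countable recursive system solves `P n = τ.q n + b n.P (n + 1)`; its solutions are constants,
which is why `IsBranch` only constrains transitions. -/
theorem exists_branch_seq (hdefs : AllowsDefinitions defs) (q : ℕ → Term Act K) (b : ℕ → Act) :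
    ∃ P : ℕ → Term Act K, ∀ n, IsBranch defs (P n) (q n) (b n) (P (n + 1)) := by
  obtain ⟨A, hA⟩ := hdefs
    (fun n => branch ((q n).mapConst .inl) (b n) (.const (.inr (n + 1))))
  refine ⟨fun n => .const (A n), fun n l p => ?_⟩
  have : defs (A n) = branch (q n) (b n) (.const (A (n + 1))) := by
    rw [hA, branch, mapConst_countableSum, branch]
    congr 1
    funext c
    cases c
    · rfl
    · simp [Term.mapConst, Term.mapConst_mapConst, Term.mapConst_id]
  rw [step_const_iff, this]
  exact isBranch_branch _ _ _ l p

/-! ### A distinguishing server for each clause. -/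

theorem ClientPreorder.usableAlong (hco : Function.Involutive co) {r₁ r₂ : Term Act K}
    (h : ClientPreorder co defs r₁ r₂) {s : List Act} (hs : UsableAlong co defs r₁ s) :
    UsableAlong co defs r₂ s := by
  refine (usableAlong_iff hco).2 fun s' hs' => ?_
  have hu := (usableAlong_iff hco).1 hs
  obtain ⟨p, hp⟩ := hu s' hs'
  exact ⟨p, fun q hq => h.mustI_of_trace hco
    ((usableAlong_iff hco).2 fun t ht => hu t (ht.trans hs')) hp hq⟩

/-- If no acceptance set of `r₁` fits, each stable residual of `r₁` offers a usable action outside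
`B`. The sum `T` of the complements of these actions satisfies the residuals of `r₁` but deadlocks
with `q₂`. -/
theorem ClientPreorder.exists_accU (hco : Function.Involutive co) {r₁ r₂ : Term Act K}
    (h : ClientPreorder co defs r₁ r₂) {s : List Act} (hs : UsableAlong co defs r₁ s)
    {B : Set Act} (hB : B ∈ accU defs r₂ s) :
    ∃ A ∈ accU defs r₁ s, A ∩ usableActions co defs r₁ s ⊆ B := by
  by_contra hcon
  obtain ⟨q₂, hq₂, hst, rfl⟩ := hB
  have hpa : ∀ a : Act, ∃ p, a ∈ usableActions co defs r₁ s →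
      ∀ q, UWT defs r₁ (s ++ [a]) q → MustI co defs (p, q) := by
    intro a
    by_cases hc : a ∈ usableActions co defs r₁ s ∧ CanUWT defs r₁ (s ++ [a])
    · obtain ⟨p, hp⟩ := (usableAlong_iff hco).1 (hc.1 hc.2) _ List.prefix_rfl
      exact ⟨p, fun _ => hp⟩
    · exact ⟨.nil, fun ha q hq => absurd ⟨ha, q, hq⟩ hc⟩
  choose pa hpa using hpa
  -- Only actions offered by residuals of `r₁` are kept: this makes `C` countable, so that `T` is a
  -- term.
  let C : Set Act := {a | (∃ q ∈ afterU defs r₁ s, a ∈ readySet defs q) ∧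
    a ∈ usableActions co defs r₁ s ∧ a ∉ readySet defs q₂}
  have hC : C.Countable := by
    refine ((afterU_countable defs r₁ s).biUnion fun q _ => countable_readySet (defs := defs) q).mono ?_
    rintro a ⟨⟨q, hq, ha⟩, -⟩
    exact Set.mem_biUnion hq ha
  have : Countable C := hC.to_subtype
  let T : Term Act K := countableSum (fun a : C => .pre (.act (co a.1)) (pa a.1))
  have hTstep : ∀ l p, Step defs T l p ↔ ∃ a ∈ C, l = .act (co a) ∧ p = pa a := by
    intro l p
    simp only [T, step_countableSum_iff, step_pre_iff, Subtype.exists, exists_prop]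
  have hT : ∀ q, UWT defs r₁ s q → MustI co defs (T, q) := by
    intro q hq
    obtain ⟨p₀, hp₀⟩ := (usableAlong_iff hco).1 hs s List.prefix_rfl
    have hqacc := (hp₀ q hq).acc_client
    induction hqacc with
    | intro q _ ih =>
      have hok := hq.not_canOk_right
      have key : ∀ z, ParStep co defs (T, q) .tau z → MustI co defs z := by
        intro z hz
        rcases (parStep_tau_iff hco).1 hz with ⟨p', h1, rfl⟩ | ⟨q', h1, rfl⟩ | ⟨b, p', q', h1, h2, rfl⟩
        · obtain ⟨a, -, h2, -⟩ := (hTstep _ _).1 h1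
          cases h2
        · by_cases hok' : CanOk defs q'
          · exact .ok _ hok'
          · exact ih q' ⟨hok, h1⟩
              (by simpa using hq.append (.tau _ _ _ _ (.refl _ hok') hok h1))
        · obtain ⟨a, ha, h3, rfl⟩ := (hTstep _ _).1 h1
          have hab : b = a := hco.injective (by injection h3 with h3; injection h3)
          subst hab
          by_cases hok' : CanOk defs q'
          · exact .ok _ hok'
          · exact hpa b ha.2.1 q' (hq.append (.act _ _ _ _ _ (.refl _ hok') hok h2))
      suffices ∃ y, ParStep co defs (T, q) .tau y by
        obtain ⟨y, hy⟩ := this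
        exact .step _ y hy key
      by_cases hqs : Stable defs q
      · have : ¬ readySet defs q ∩ usableActions co defs r₁ s ⊆ readySet defs q₂ :=
          fun hsub => hcon ⟨_, ⟨q, hq, hqs, rfl⟩, hsub⟩
        obtain ⟨a, ⟨ha1, ha2⟩, ha3⟩ := Set.not_subset.1 this
        have haC : a ∈ C := ⟨⟨q, hq, ha1⟩, ha2, ha3⟩
        obtain ⟨q', hq'⟩ := ha1
        exact ⟨_, (parStep_tau_iff hco).2
          (.inr (.inr ⟨a, pa a, q', (hTstep _ _).2 ⟨a, haC, rfl, rfl⟩, hq', rfl⟩))⟩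
      · obtain ⟨q', h⟩ := not_not.1 hqs
        exact ⟨_, .right _ _ q' _ h⟩
  obtain ⟨y, hy⟩ := (h.mustI_of_trace hco hs hT hq₂).exists_parStep hq₂.not_canOk_right
  rcases (parStep_tau_iff hco).1 hy with ⟨p', h1, -⟩ | ⟨q', h1, -⟩ | ⟨b, p', q', h1, h2, -⟩
  · obtain ⟨a, -, h2, -⟩ := (hTstep _ _).1 h1
    cases h2
  · exact hst ⟨q', h1⟩
  · obtain ⟨a, ha, h3, -⟩ := (hTstep _ _).1 h1
    have hab : b = a := hco.injective (by injection h3 with h3; injection h3)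
    subst hab
    exact ha.2.2 ⟨q', h2⟩

theorem ClientPreorder.canUWT (hco : Function.Involutive co) (hdefs : AllowsDefinitions defs)
    {r₁ r₂ : Term Act K} (h : ClientPreorder co defs r₁ r₂) {s : List Act}
    (hs : UsableAlong co defs r₁ s) (h₂ : CanUWT defs r₂ s) : CanUWT defs r₁ s := by
  by_contra hcon
  obtain ⟨q, hq⟩ := h₂
  obtain ⟨Ω, hΩ⟩ := exists_divergent hdefs
  -- Without `s`-residuals of `r₁`, even a divergent server satisfies all of them.
  have hm := h.mustI_of_trace hco hs (T := Ω) (fun q hq => absurd ⟨q, hq⟩ hcon) hq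
  exact not_acc_of_descending (hm.acc_server hq.not_canOk_right) (fun _ => Ω) rfl (fun _ => hΩ)

theorem ClientPreorder.canUWTInf (hco : Function.Involutive co) (hdefs : AllowsDefinitions defs)
    {r₁ r₂ : Term Act K} (h : ClientPreorder co defs r₁ r₂) {w : ℕ → Act}
    (hw : UsableAlongInf co defs r₁ w) (h₂ : CanUWTInf defs r₂ w) : CanUWTInf defs r₁ w := by
  by_contra hcon
  -- The `n`th escape server satisfies all residuals of `r₁` after the first `n` actions.
  choose q hq using fun n => (usableAlong_iff hco).1 (hw n) _ List.prefix_rfl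
  obtain ⟨P, hP⟩ := exists_branch_seq hdefs q (fun n => co (w n))
  have hP₁ : MustI co defs (P 0, r₁) := by
    by_contra hn
    have hok : ¬ CanOk defs r₁ := fun h => hn (.ok _ h)
    -- By `IsBranch.mustI` failure can only be passed along the next action of `w`, so it would make
    -- `r₁` perform all of `w`.
    obtain ⟨f, h0, hf⟩ := exists_seq_of_step (x := ((0 : ℕ), r₁))
      (P := fun x => UWT defs r₁ (takePrefix w x.1) x.2 ∧ ¬ MustI co defs (P x.1, x.2))
      (R := fun x y => y.1 = x.1 + 1 ∧ UWT defs x.2 [w x.1] y.2)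
      (by exact ⟨.refl _ hok, hn⟩) (by
        rintro ⟨n, r⟩ ⟨h1, h2⟩
        dsimp only at h1 h2
        by_contra hc
        refine h2 ((hP n).mustI hco (fun _ => hq n r h1) fun r' hr' => ?_)
        by_contra h3
        exact hc ⟨(n + 1, r'), ⟨rfl, hr'⟩, by rw [takePrefix_succ]; exact h1.append hr', h3⟩)
    have hn' : ∀ n, (f n).1 = n := by
      intro n
      induction n with
      | zero => rw [h0]
      | succ n ih => rw [(hf n).2.1, ih]
    have := canUWTInf_of_seq (defs := defs) (w := w) (q := fun n => (f n).2) (fun n => by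
      have := (hf n).2.2
      rwa [hn'] at this)
    rw [h0] at this
    exact hcon this
  obtain ⟨q₂, hq0, hq₂⟩ := h₂.exists_seq
  have hP₂ := must_iff.1 (h (P 0) (must_iff.2 hP₁))
  refine MustI.not_seq hco (p := P) (q := q₂) (hq0 ▸ hP₂) (fun n => ?_) hq₂
  exact .act _ _ _ _ _ (.refl _) ((hP n _ _).2 (.inr ⟨rfl, rfl⟩))

end

end CCS

theorem mainTheorem1 {Act : Type*} {K : Type*}
    (co : Act → Act) (hco : Function.Involutive co)
    (defs : K → CCS.Term Act K) (hdefs : CCS.AllowsDefinitions defs)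
    (r₁ r₂ : CCS.Term Act K) :
    CCS.ClientPreorder co defs r₁ r₂ ↔ CCS.SemanticClientPreorder co defs r₁ r₂ :=
  ⟨fun h => ⟨fun _ hs => ⟨h.usableAlong hco hs, fun _ hB => h.exists_accU hco hs hB⟩,
    fun _ hs h₂ => h.canUWT hco hdefs hs h₂, fun _ hw h₂ => h.canUWTInf hco hdefs hw h₂⟩,
    fun h => h.clientPreorder hco⟩
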